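/- Let $K$ be an abelian number field (a finite abelian Galois extension of $\mathbb{Q}$) of conductor $p^r$, where $p$ is an odd prime and $r \ge 2$; here the conductor of $K$ is the least integer $m \ge 1$ such that $K$ embeds into the cyclotomic field $\mathbb{Q}(\zeta_m)$. Let $n = [K:\mathbb{Q}]$, let $\mathcal{O}_K$ be the ring of integers of $K$, let $D_K$ be the absolute value of the discriminant of $K$, and let $$M(K) = \sup_{x \in K}\ \inf_{c \in \mathcal{O}_K} \left|N_{K/\mathbb{Q}}(x-c)\right|$$ be the Euclidean minimum of $K$. Then $$M(K) \le 2^{-n}\sqrt{D_K}.$$ In particular, Minkowski's conjecture (that this inequality holds for every totally real number field) is true for the totally real fields of this kind. -/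

import Mathlib

namespace EuclideanMinimum

/-- The conductor of an abelian number field: the least positive integer `m` such that `K` embeds
into the `m`-th cyclotomic field `ℚ(ζ_m)`. -/
noncomputable def conductor (K : Type*) [Field K] [NumberField K] : ℕ :=
  sInf {m : ℕ | 0 < m ∧ Nonempty (K →+* CyclotomicField m ℚ)}

/-- The absolute value of the norm map of `K / ℚ`, as a nonnegative extended real. -/
noncomputable def absNorm {K : Type*} [Field K] [NumberField K] (x : K) : ENNReal :=
  ENNReal.ofReal ((|Algebra.norm ℚ x| : ℚ) : ℝ)

/-- The Euclidean minimum `M(K) = sup_{x ∈ K} inf_{c ∈ 𝓞 K} |N(x - c)|`. It is taken in `[0, ∞]`, so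
that the supremum always exists; a finite upper bound for it includes its finiteness. -/
noncomputable def euclideanMinimum (K : Type*) [Field K] [NumberField K] : ENNReal :=
  ⨆ x : K, ⨅ c : NumberField.RingOfIntegers K, absNorm (x - (c : K))

end EuclideanMinimum

/-! Put r = k + 1, let L = ℚ(ζ) with ζ of order p^(k+1), and view H = Gal(L/K) inside (ℤ/p^(k+1))ˣ,
which is cyclic since p is odd. If H contained a nontrivial unit congruent to 1 mod p, it would
contain the whole kernel of reduction to (ℤ/p^k)ˣ, and K would lie in ℚ(ζ^p), against the conductor
(`isUnit_autToPow_sub_one`). Hence |H| < p, and every ζ - σζ with σ ≠ 1 in H has norm ±p. The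
different of L/K is therefore small: D_L ≤ p^(|H|-1) D_K^|H|, which bounds D_K from below.

On the other side, x in K is a combination of the ζ^i, i in ℤ/p^(k+1), with H-invariant rational
coefficients. Shifting all of them by one real t changes no embedding, as ∑ ζ^i = 0, and rounding
keeps the invariance, so it produces c in 𝓞 K. Averaging over t yields a c for which the trace form
of x - c is at most p^(2k) (p^2 - 1)/12 (`exists_ringOfIntegers_sum_embeddings_normSq_le`). AM-GM
turns this into a bound for the norm, and `pow_mul_succ_pow_le_three_mul_pow` compares it with D_K.
-/

/-! ### Rounding after a common random shift -/

open MeasureTheory in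
theorem integrableOn_sub_round_sq_comp (a b : ℝ) :
    IntegrableOn (fun t : ℝ ↦ (a - b * t - round (a - b * t)) ^ 2) (Set.Ioc 0 1) := by
  refine Measure.integrableOn_of_bounded (M := 1) (by simp) ?_ ?_
  · have h : Measurable fun x : ℝ ↦ (x - round x) ^ 2 := by
      have : Measurable fun x : ℝ ↦ ((round x : ℤ) : ℝ) := by
        simp only [round_eq]
        fun_prop
      fun_prop
    exact (h.comp (by fun_prop : Measurable fun t : ℝ ↦ a - b * t)).aestronglyMeasurable
  · refine Filter.Eventually.of_forall fun t ↦ ?_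
    have h := abs_sub_round (a - b * t)
    rw [Real.norm_eq_abs, abs_pow]
    exact pow_le_one₀ (abs_nonneg _) (by linarith)

theorem integral_sub_round_sq : ∫ x in (-(1 / 2) : ℝ)..(1 / 2), (x - round x) ^ 2 = 1 / 12 := by
  have h : ∫ x in (-(1 / 2) : ℝ)..(1 / 2), (x - round x) ^ 2 =
      ∫ x in (-(1 / 2) : ℝ)..(1 / 2), x ^ 2 := by
    refine intervalIntegral.integral_congr_ae ?_
    have : ∀ᵐ x : ℝ, x ≠ 1 / 2 := by
      simp [MeasureTheory.ae_iff]
    filter_upwards [this] with x hx hmem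
    rw [Set.uIoc_of_le (by norm_num)] at hmem
    have : round x = 0 := by
      rw [round_eq_zero_iff]
      exact ⟨hmem.1.le, lt_of_le_of_ne hmem.2 hx⟩
    simp [this]
  rw [h, integral_pow]
  norm_num

/-- The substitution x = c - p t gives 1/p times an integral over p full periods. -/
theorem integral_sub_round_sq_comp (c : ℝ) {p : ℕ} (hp : 0 < p) :
    ∫ t in (0 : ℝ)..1, (c - p * t - round (c - p * t)) ^ 2 = 1 / 12 := by
  have hper : Function.Periodic (fun x : ℝ ↦ (x - round x) ^ 2) 1 := fun x ↦ by simp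
  have hp' : (p : ℝ) ≠ 0 := by positivity
  rw [intervalIntegral.integral_comp_sub_mul (fun x : ℝ ↦ (x - round x) ^ 2) hp' c]
  have h := hper.intervalIntegral_add_zsmul_eq (p : ℤ) (c - p)
    (hper.intervalIntegrable₀ (by norm_num) ?_)
  · have h2 := hper.intervalIntegral_add_eq (c - p) (-(1 / 2))
    rw [show (-(1 / 2) : ℝ) + 1 = 1 / 2 by norm_num, integral_sub_round_sq] at h2
    simp only [natCast_zsmul, nsmul_eq_mul, mul_one, sub_add_cancel, h2] at h
    simp only [mul_one, mul_zero, sub_zero, smul_eq_mul, h]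
    field_simp
  · rw [intervalIntegrable_iff, Set.uIoc_of_le zero_le_one]
    simpa using integrableOn_sub_round_sq_comp 0 (-1)

/-- Rounding all coordinates after one common shift: on average over the shift, the residues
satisfy the covering bound of a sum of dual root lattices of type `A`. -/
theorem exists_shift_sum_sub_round_sq_le {ι κ : Type*} [Fintype ι] [Fintype κ] [DecidableEq κ]
    (π : ι → κ) {p : ℕ} (hp : 0 < p) (hπ : ∀ k, (Finset.univ.filter fun i ↦ π i = k).card = p)
    (a : ι → ℝ) :
    ∃ t : ℝ, Fintype.card ι * ∑ i, (a i - t - round (a i - t)) ^ 2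
      - Fintype.card κ * ∑ k, (∑ i with π i = k, (a i - t - round (a i - t))) ^ 2
      ≤ (Fintype.card κ : ℝ) ^ 2 * ((p : ℝ) ^ 2 - 1) / 12 := by
  have hcard : Fintype.card ι = p * Fintype.card κ := by
    rw [← Finset.card_univ, Finset.card_eq_sum_card_fiberwise (f := π) (t := Finset.univ) (by simp)]
    simp [hπ, mul_comm]
  set A : κ → ℝ := fun k ↦ ∑ i with π i = k, a i
  -- Fibre sums of residues are replaced by the distance from `A k - p * t` to the nearest integer,
  -- so that every term has mean 1/12.
  let F : ℝ → ℝ := fun t ↦ Fintype.card ι * ∑ i, (a i - 1 * t - round (a i - 1 * t)) ^ 2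
      - Fintype.card κ * ∑ k, (A k - p * t - round (A k - p * t)) ^ 2
  have hint1 := fun i ↦ integrableOn_sub_round_sq_comp (a i) 1
  have hint2 := fun k ↦ integrableOn_sub_round_sq_comp (A k) p
  have hF1 : MeasureTheory.IntegrableOn (fun t : ℝ ↦ (Fintype.card ι : ℝ) *
      ∑ i, (a i - 1 * t - round (a i - 1 * t)) ^ 2) (Set.Ioc 0 1) :=
    (MeasureTheory.integrable_finsetSum _ fun i _ ↦ hint1 i).const_mul _
  have hF2 : MeasureTheory.IntegrableOn (fun t : ℝ ↦ (Fintype.card κ : ℝ) *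
      ∑ k, (A k - p * t - round (A k - p * t)) ^ 2) (Set.Ioc 0 1) :=
    (MeasureTheory.integrable_finsetSum _ fun i _ ↦ hint2 i).const_mul _
  have hval : ∫ t in Set.Ioc (0 : ℝ) 1, F t =
      (Fintype.card κ : ℝ) ^ 2 * ((p : ℝ) ^ 2 - 1) / 12 := by
    have e1 : ∀ i, ∫ t in Set.Ioc (0 : ℝ) 1, (a i - 1 * t - round (a i - 1 * t)) ^ 2 = 1 / 12 := by
      intro i
      rw [← intervalIntegral.integral_of_le zero_le_one]
      simpa using integral_sub_round_sq_comp (a i) one_pos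
    have e2 : ∀ k, ∫ t in Set.Ioc (0 : ℝ) 1, (A k - p * t - round (A k - p * t)) ^ 2 = 1 / 12 := by
      intro k
      rw [← intervalIntegral.integral_of_le zero_le_one]
      exact integral_sub_round_sq_comp (A k) hp
    rw [MeasureTheory.integral_sub hF1 hF2, MeasureTheory.integral_const_mul,
      MeasureTheory.integral_const_mul, MeasureTheory.integral_finsetSum _ fun i _ ↦ hint1 i,
      MeasureTheory.integral_finsetSum _ fun i _ ↦ hint2 i]
    simp only [e1, e2, Finset.sum_const, Finset.card_univ, nsmul_eq_mul, hcard]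
    push_cast
    ring
  obtain ⟨t, -, ht⟩ := MeasureTheory.exists_le_setAverage (μ := MeasureTheory.volume)
    (s := Set.Ioc (0 : ℝ) 1) (f := F) (by simp) (by simp) (hF1.sub hF2)
  rw [MeasureTheory.setAverage_eq, hval] at ht
  simp only [MeasureTheory.Measure.real, Real.volume_Ioc, sub_zero, ENNReal.ofReal_one,
    ENNReal.toReal_one, inv_one, one_smul, F, one_mul] at ht
  refine ⟨t, le_trans ?_ ht⟩
  refine sub_le_sub_left (mul_le_mul_of_nonneg_left (Finset.sum_le_sum fun k _ ↦ ?_)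
    (Nat.cast_nonneg _)) _
  -- The fibre sum differs from `A k - p * t` by the integer `R`, so its square is at least the
  -- squared distance to the nearest integer; it enters with a minus sign.
  set R : ℤ := ∑ i with π i = k, round (a i - t) with hR
  have hsum : ∑ i with π i = k, (a i - t - round (a i - t)) = A k - p * t - R := by
    simp only [Finset.sum_sub_distrib, Finset.sum_const, hπ, nsmul_eq_mul, hR, Int.cast_sum, A]
  rw [hsum]
  exact sq_le_sq.2 (round_le _ _)

/-! ### Parseval's identity over roots of unity -/

theorem sum_nthRootsFinset_pow {M : ℕ} (hM : 0 < M) (j : ℕ) :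
    ∑ ω ∈ Polynomial.nthRootsFinset M (1 : ℂ), ω ^ j = if M ∣ j then (M : ℂ) else 0 := by
  have hω := Complex.isPrimitiveRoot_exp M hM.ne'
  set ω₀ := Complex.exp (2 * Real.pi * Complex.I / M)
  split_ifs with h
  · rw [Finset.sum_congr rfl (g := fun _ ↦ (1 : ℂ))]
    · simp [hω.card_nthRootsFinset]
    · intro ω hmem
      obtain ⟨c, rfl⟩ := h
      rw [pow_mul, (Polynomial.mem_nthRootsFinset hM _).1 hmem, one_pow]
  · have h1 : ω₀ ^ j ≠ 1 := fun h' ↦ h (hω.dvd_of_pow_eq_one j h')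
    have h0 : ω₀ ≠ 0 := hω.ne_zero hM.ne'
    have hpow : ω₀ ^ M = 1 := hω.pow_eq_one
    have key : ∑ ω ∈ Polynomial.nthRootsFinset M (1 : ℂ), ω ^ j =
        ω₀ ^ j * ∑ ω ∈ Polynomial.nthRootsFinset M (1 : ℂ), ω ^ j := by
      rw [Finset.mul_sum]
      refine Finset.sum_nbij' (fun ω ↦ ω₀⁻¹ * ω) (fun ω ↦ ω₀ * ω) ?_ ?_ ?_ ?_ ?_
      · intro ω hm
        rw [Polynomial.mem_nthRootsFinset hM] at hm ⊢
        simp [mul_pow, hpow, hm]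
      · intro ω hm
        rw [Polynomial.mem_nthRootsFinset hM] at hm ⊢
        simp [mul_pow, hpow, hm]
      · intro ω _
        simp [h0]
      · intro ω _
        simp [h0]
      · intro ω _
        rw [← mul_pow, mul_inv_cancel_left₀ h0]
    have : (1 - ω₀ ^ j) * ∑ ω ∈ Polynomial.nthRootsFinset M (1 : ℂ), ω ^ j = 0 := by
      rw [sub_mul, one_mul, ← key, sub_self]
    exact (mul_eq_zero.1 this).resolve_left (sub_ne_zero.2 (Ne.symm h1))

theorem sum_nthRootsFinset_normSq {M : ℕ} [NeZero M] (U : ZMod M → ℝ) :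
    ∑ ω ∈ Polynomial.nthRootsFinset M (1 : ℂ), ‖∑ k, (U k : ℂ) * ω ^ k.val‖ ^ 2 =
      M * ∑ k, U k ^ 2 := by
  have hM : 0 < M := Nat.pos_of_neZero M
  apply Complex.ofReal_injective
  push_cast
  have h : ∀ ω ∈ Polynomial.nthRootsFinset M (1 : ℂ),
      (‖∑ k, (U k : ℂ) * ω ^ k.val‖ : ℂ) ^ 2 =
        ∑ k, ∑ l, (U k : ℂ) * U l * ω ^ (k.val + (M - l.val)) := by
    intro ω hω
    rw [Polynomial.mem_nthRootsFinset hM] at hω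
    have hn : (starRingEnd ℂ) ω * ω = 1 := by
      rw [mul_comm, Complex.mul_conj']
      have := Complex.norm_eq_one_of_pow_eq_one hω hM.ne'
      simp [this]
    rw [← Complex.mul_conj', map_sum, Finset.sum_mul_sum]
    refine Finset.sum_congr rfl fun k _ ↦ Finset.sum_congr rfl fun l _ ↦ ?_
    have hl : (starRingEnd ℂ) ω ^ l.val = ω ^ (M - l.val) := by
      have h1 : ω ^ (M - l.val) * ω ^ l.val = 1 := by
        rw [← pow_add, Nat.sub_add_cancel (ZMod.val_lt l).le, hω]
      have h2 : (starRingEnd ℂ) ω ^ l.val * ω ^ l.val = 1 := by rw [← mul_pow, hn, one_pow]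
      have h3 : ω ^ l.val ≠ 0 := right_ne_zero_of_mul_eq_one h1
      exact mul_right_cancel₀ h3 (h2.trans h1.symm)
    rw [map_mul, map_pow, hl, Complex.conj_ofReal, pow_add]
    ring
  rw [Finset.sum_congr rfl h, Finset.sum_comm, Finset.mul_sum]
  refine Finset.sum_congr rfl fun k _ ↦ ?_
  rw [Finset.sum_comm]
  simp_rw [← Finset.mul_sum, sum_nthRootsFinset_pow hM]
  rw [Finset.sum_eq_single k]
  · rw [if_pos ⟨1, by have := ZMod.val_lt k; omega⟩]
    ring
  · intro l _ hlk
    rw [if_neg, mul_zero]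
    rintro ⟨c, hc⟩
    have h1 := ZMod.val_lt k
    have h2 := ZMod.val_lt l
    have h3 : k.val ≠ l.val := fun h ↦ hlk (ZMod.val_injective M h.symm)
    -- The exponent k + (M - l) lies strictly between 0 and 2M.
    have : c = 1 := by
      have hc0 : 0 < c := by
        rcases Nat.eq_zero_or_pos c with rfl | h
        · omega
        · exact h
      have hc2 : c < 2 := by
        by_contra! h
        have := Nat.mul_le_mul_left M h
        omega
      omega
    subst this
    omega
  · simp

/-! ### Units modulo p^(k+1) and the Galois group of L/K -/

theorem ZMod.exists_eq_natCast_mul_of_castHom_eq_zero {m n : ℕ} [NeZero n] (h : m ∣ n) {x : ZMod n}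
    (hx : ZMod.castHom h (ZMod m) x = 0) : ∃ y : ZMod n, x = m * y := by
  rw [← ZMod.natCast_zmod_val x, map_natCast, ZMod.natCast_eq_zero_iff] at hx
  obtain ⟨c, hc⟩ := hx
  exact ⟨c, by rw [← ZMod.natCast_zmod_val x, hc, Nat.cast_mul]⟩

theorem ZMod.exists_eq_natCast_mul_of_not_isUnit {p k : ℕ} (hp : p.Prime) {x : ZMod (p ^ (k + 1))}
    (hx : ¬IsUnit x) : ∃ y : ZMod (p ^ (k + 1)), x = p * y := by
  have : NeZero (p ^ (k + 1)) := ⟨(pow_pos hp.pos _).ne'⟩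
  rw [← ZMod.natCast_zmod_val x, ZMod.isUnit_iff_coprime,
    Nat.coprime_pow_right_iff k.succ_pos, Nat.coprime_comm, hp.coprime_iff_not_dvd, not_not] at hx
  obtain ⟨c, hc⟩ := hx
  exact ⟨c, by rw [← ZMod.natCast_zmod_val x, hc, Nat.cast_mul]⟩

/-- In `(ℤ/p^(k+1))ˣ`, a nontrivial unit congruent to `1` modulo `p` generates every unit that is
congruent to `1` modulo `p^k`. -/
theorem ZMod.mem_zpowers_of_castHom_eq_one {p k : ℕ} (hp : p.Prime) (hp2 : p ≠ 2) (hk : k ≠ 0)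
    {u w : (ZMod (p ^ (k + 1)))ˣ} (hu : ¬IsUnit ((u : ZMod (p ^ (k + 1))) - 1)) (hu1 : u ≠ 1)
    (hw : ZMod.castHom (pow_dvd_pow p k.le_succ) (ZMod (p ^ k)) w = 1) :
    w ∈ Subgroup.zpowers u := by
  have : NeZero (p ^ (k + 1)) := ⟨(pow_pos hp.pos _).ne'⟩
  have : Fact p.Prime := ⟨hp⟩
  have := ZMod.isCyclic_units_of_prime_pow p hp hp2 (k + 1)
  have hzero : ((p : ZMod (p ^ (k + 1)))) ^ (k + 1) = 0 := by
    exact_mod_cast ZMod.natCast_self (p ^ (k + 1))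
  have hupow : u ^ p ^ k = 1 := by
    obtain ⟨y, hy⟩ := ZMod.exists_eq_natCast_mul_of_not_isUnit hp hu
    have h := dvd_sub_pow_of_dvd_sub (p := p) (a := (u : ZMod (p ^ (k + 1)))) (b := 1) ⟨y, hy⟩ k
    rw [hzero, zero_dvd_iff, one_pow, sub_eq_zero] at h
    exact Units.ext (by simpa using h)
  have hwpow : w ^ p = 1 := by
    obtain ⟨y, hy⟩ := ZMod.exists_eq_natCast_mul_of_castHom_eq_zero (pow_dvd_pow p k.le_succ)
      (x := (w : ZMod (p ^ (k + 1))) - 1) (by rw [map_sub, hw, map_one, sub_self])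
    -- Used for z = p^k y, whose square vanishes because 2k ≥ k + 1; this needs k ≠ 0.
    have hz : ∀ z : ZMod (p ^ (k + 1)), z * z = 0 → ∀ n : ℕ, (1 + z) ^ n = 1 + n * z := by
      intro z hz n
      induction n with
      | zero => simp
      | succ n ih =>
        rw [pow_succ (1 + z), ih, Nat.cast_succ]
        linear_combination (n : ZMod (p ^ (k + 1))) * hz
    have hw' : (w : ZMod (p ^ (k + 1))) = 1 + (p ^ k : ℕ) * y := by rw [← hy]; ring
    apply Units.ext
    rw [Units.val_pow_eq_pow_val, hw', hz]
    · push_cast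
      linear_combination y * hzero
    · obtain ⟨j, rfl⟩ : ∃ j, k = j + 1 := ⟨k - 1, by omega⟩
      push_cast
      calc _ = (p : ZMod (p ^ (j + 1 + 1))) ^ (j + 1 + 1) * (p ^ j * y ^ 2) := by ring
        _ = 0 := by rw [hzero, zero_mul]
  obtain ⟨j, -, hj⟩ := (Nat.dvd_prime_pow hp).1 (orderOf_dvd_of_pow_eq_one hupow)
  obtain ⟨i, rfl⟩ : ∃ i, j = i + 1 := by
    refine Nat.exists_eq_succ_of_ne_zero ?_
    rintro rfl
    exact hu1 (orderOf_eq_one_iff.1 (by simpa using hj))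
  have hv : orderOf (u ^ p ^ i) = p := by
    rw [orderOf_pow' _ (pow_pos hp.pos i).ne', hj, Nat.gcd_eq_right (pow_dvd_pow p i.le_succ),
      pow_succ, Nat.mul_div_cancel_left _ (pow_pos hp.pos i)]
  set v := u ^ p ^ i with hv_def
  suffices w ∈ Subgroup.zpowers v from
    (Subgroup.zpowers_le.2 (Subgroup.pow_mem _ (Subgroup.mem_zpowers u) _)) this
  classical
  -- A cyclic group has at most p solutions of x^p = 1, and the powers of `v` already supply p of
  -- them, so `w` is one of these powers.
  have hcard := IsCyclic.card_pow_eq_one_le (α := (ZMod (p ^ (k + 1)))ˣ) hp.pos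
  have hsub : (Finset.univ.filter fun x ↦ x ∈ Subgroup.zpowers v) ⊆
      Finset.univ.filter fun x : (ZMod (p ^ (k + 1)))ˣ ↦ x ^ p = 1 := by
    intro x hx
    simp only [Finset.mem_filter, Finset.mem_univ, true_and] at hx ⊢
    obtain ⟨m, rfl⟩ := Subgroup.mem_zpowers_iff.1 hx
    have h := zpow_pow_orderOf (x := v) (i := m)
    rwa [hv] at h
  have hcard2 : (Finset.univ.filter fun x ↦ x ∈ Subgroup.zpowers v).card = p := by
    refine Eq.trans ?_ hv
    rw [← Nat.card_zpowers, Nat.card_eq_fintype_card, Fintype.card_subtype]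
  have heq := Finset.eq_of_subset_of_card_le hsub (by rw [hcard2]; exact hcard)
  have : w ∈ Finset.univ.filter fun x : (ZMod (p ^ (k + 1)))ˣ ↦ x ^ p = 1 := by simp [hwpow]
  rw [← heq] at this
  simpa using this

theorem IsPrimitiveRoot.pow_eq_pow_iff_natCast_eq {M : Type*} [CommMonoid M] {ζ : M} {n : ℕ}
    [NeZero n] (hζ : IsPrimitiveRoot ζ n) {a b : ℕ} : ζ ^ a = ζ ^ b ↔ (a : ZMod n) = b := by
  have h : IsOfFinOrder ζ := isOfFinOrder_iff_pow_eq_one.2 ⟨n, Nat.pos_of_neZero n, hζ.pow_eq_one⟩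
  rw [h.pow_eq_pow_iff_modEq, ← hζ.eq_orderOf, ZMod.natCast_eq_natCast_iff]

theorem Algebra.adjoin_singleton_eq_top_of_tower (k K : Type*) {L : Type*} [CommSemiring k]
    [CommSemiring K] [CommSemiring L] [Algebra k K] [Algebra K L] [Algebra k L]
    [IsScalarTower k K L] {x : L} (hx : Algebra.adjoin k {x} = ⊤) : Algebra.adjoin K {x} = ⊤ := by
  refine Algebra.eq_top_iff.2 fun y ↦ ?_
  have hy : y ∈ Algebra.adjoin k {x} := hx ▸ Algebra.mem_top
  clear hx
  induction hy using Algebra.adjoin_induction with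
  | mem y hy => exact Algebra.subset_adjoin hy
  | algebraMap q =>
    rw [IsScalarTower.algebraMap_apply k K L]
    exact Subalgebra.algebraMap_mem _ _
  | add a b _ _ ha hb => exact add_mem ha hb
  | mul a b _ _ ha hb => exact mul_mem ha hb

/-- If `K` lies in the `p^(k+1)`-st cyclotomic field `L` but does not embed into the `p^k`-th one,
then `Gal(L/K)` meets the units congruent to `1` modulo `p` trivially. -/
theorem isUnit_autToPow_sub_one {p k : ℕ} [Fact p.Prime] (hp2 : p ≠ 2) (hk : k ≠ 0)
    {K L : Type*} [Field K] [NumberField K] [Field L] [NumberField L] [Algebra K L]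
    [IsCyclotomicExtension {p ^ (k + 1)} ℚ L] {ζ : L} (hζ : IsPrimitiveRoot ζ (p ^ (k + 1)))
    {C : Type*} [Field C] [Algebra ℚ C] [IsCyclotomicExtension {p ^ k} ℚ C] (hK : IsEmpty (K →+* C))
    {σ : L ≃ₐ[K] L} (hσ : σ ≠ 1) :
    IsUnit ((hζ.autToPow K σ : ZMod (p ^ (k + 1))) - 1) := by
  have hp : p.Prime := Fact.out
  have hval : (hζ.autToPow K σ : ZMod (p ^ (k + 1))) =
      hζ.autToPow ℚ (σ.restrictScalars ℚ) := by
    apply ZMod.val_injective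
    apply hζ.pow_inj (ZMod.val_lt _) (ZMod.val_lt _)
    rw [hζ.autToPow_spec K, hζ.autToPow_spec ℚ]
    rfl
  rw [hval]
  by_contra hu
  have hu1 : hζ.autToPow ℚ (σ.restrictScalars ℚ) ≠ 1 := by
    intro h
    rw [← map_one (hζ.autToPow ℚ)] at h
    have := hζ.autToPow_injective (K := ℚ) h
    exact hσ (AlgEquiv.ext fun x ↦ by simpa using DFunLike.congr_fun this x)
  have : NeZero (p ^ k) := ⟨(pow_pos hp.pos _).ne'⟩
  have hζp : IsPrimitiveRoot (ζ ^ p) (p ^ k) :=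
    hζ.pow (pow_pos hp.pos _) (pow_succ' p k)
  have hζ' := IsCyclotomicExtension.zeta_spec (p ^ k) ℚ C
  have hirr : Irreducible (Polynomial.cyclotomic (p ^ k) ℚ) :=
    Polynomial.cyclotomic.irreducible_rat (pow_pos hp.pos _)
  let f : C →ₐ[ℚ] L := (hζ'.embeddingsEquivPrimitiveRoots L hirr).symm
    ⟨ζ ^ p, (mem_primitiveRoots (pow_pos hp.pos _)).2 hζp⟩
  have hf : f (IsCyclotomicExtension.zeta (p ^ k) ℚ C) = ζ ^ p := by
    rw [← hζ'.embeddingsEquivPrimitiveRoots_apply_coe L hirr f, Equiv.apply_symm_apply]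
  have : IsGalois ℚ L := IsCyclotomicExtension.isGalois {p ^ (k + 1)} ℚ L
  -- An automorphism τ fixing ζ^p corresponds to a unit congruent to 1 mod p^k, hence is a power of
  -- σ and fixes K. By Galois theory K lies in the image of C.
  have hmem : ∀ x : K, algebraMap K L x ∈ f.range := by
    intro x
    have h := (IsGalois.mem_range_algebraMap_iff_fixed (F := f.fieldRange) (E := L)
      (algebraMap K L x)).2 ?_
    · obtain ⟨⟨y, hy⟩, hyx⟩ := h
      rw [← hyx]
      exact hy
    intro τ
    have hτζ : τ (ζ ^ p) = ζ ^ p := τ.commutes ⟨ζ ^ p, _, hf⟩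
    set w := hζ.autToPow ℚ (τ.restrictScalars ℚ) with hw
    have hwζ : ζ ^ (w : ZMod (p ^ (k + 1))).val = τ ζ := hζ.autToPow_spec ℚ _
    have hw1 : ZMod.castHom (pow_dvd_pow p k.le_succ) (ZMod (p ^ k)) w = 1 := by
      have h1 : (ζ ^ p) ^ (w : ZMod (p ^ (k + 1))).val = (ζ ^ p) ^ 1 := by
        rw [pow_right_comm, hwζ, ← map_pow, hτζ, pow_one]
      rw [hζp.pow_eq_pow_iff_natCast_eq] at h1
      rw [← ZMod.natCast_zmod_val (w : ZMod (p ^ (k + 1))), map_natCast, h1, Nat.cast_one]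
    obtain ⟨m, hm⟩ := Subgroup.mem_zpowers_iff.1
      (ZMod.mem_zpowers_of_castHom_eq_one hp hp2 hk hu hu1 hw1)
    rw [hw, ← map_zpow] at hm
    have hm' := hζ.autToPow_injective (K := ℚ) hm
    have hfix : ∀ m : ℤ, ((σ.restrictScalars ℚ) ^ m) (algebraMap K L x) = algebraMap K L x := by
      have : σ.restrictScalars ℚ ∈ MulAction.stabilizer (L ≃ₐ[ℚ] L) (algebraMap K L x) :=
        σ.commutes x
      exact fun m ↦ Subgroup.zpow_mem _ this m
    have h2 := DFunLike.congr_fun hm' (algebraMap K L x)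
    rw [hfix] at h2
    exact h2.symm
  exact hK.false (((AlgEquiv.ofInjectiveField f).symm : f.range →+* C).comp
    ((algebraMap K L).codRestrict f.range hmem))

/-! ### The different of L/K and the discriminant of K -/

open Polynomial in
theorem minpoly_map_eq_prod_of_adjoin_eq_top {K L : Type*} [Field K] [Field L] [Algebra K L]
    [FiniteDimensional K L] [IsGalois K L] {x : L} (hx : Algebra.adjoin K {x} = ⊤) :
    (minpoly K x).map (algebraMap K L) = ∏ σ : L ≃ₐ[K] L, (X - C (σ x)) := by
  have hinj : Function.Injective fun σ : L ≃ₐ[K] L ↦ σ x := by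
    intro σ τ h
    have : (σ : L →ₐ[K] L) = τ :=
      AlgHom.ext_of_adjoin_eq_top hx (by intro y hy; rw [Set.mem_singleton_iff.1 hy]; exact h)
    exact AlgEquiv.coe_toAlgHom_injective this
  have hint : IsIntegral K x := Algebra.IsIntegral.isIntegral x
  refine eq_of_monic_of_dvd_of_natDegree_le (monic_prod_of_monic _ _ fun σ _ ↦ monic_X_sub_C _)
    ((minpoly.monic hint).map _) ?_ ?_
  · refine Finset.prod_dvd_of_coprime ?_ fun σ _ ↦ ?_
    · exact fun σ _ τ _ h ↦ pairwise_coprime_X_sub_C hinj h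
    · rw [dvd_iff_isRoot, IsRoot, eval_map_algebraMap, aeval_algHom_apply, minpoly.aeval, map_zero]
  · rw [natDegree_map, natDegree_prod_of_monic _ _ fun σ _ ↦ monic_X_sub_C _]
    simp only [natDegree_X_sub_C, Finset.sum_const, Finset.card_univ, smul_eq_mul, mul_one]
    rw [← Nat.card_eq_fintype_card, IsGalois.card_aut_eq_finrank]
    exact minpoly.natDegree_le x

open Polynomial in
theorem aeval_derivative_minpoly_eq_prod {K L : Type*} [Field K] [Field L] [Algebra K L]
    [FiniteDimensional K L] [IsGalois K L] [DecidableEq (L ≃ₐ[K] L)]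
    {x : L} (hx : Algebra.adjoin K {x} = ⊤) :
    aeval x (derivative (minpoly K x)) = ∏ σ ∈ Finset.univ.erase (1 : L ≃ₐ[K] L), (x - σ x) := by
  rw [← eval_map_algebraMap, ← derivative_map, minpoly_map_eq_prod_of_adjoin_eq_top hx,
    ← Finset.mul_prod_erase _ _ (Finset.mem_univ (1 : L ≃ₐ[K] L)), derivative_mul]
  simp [eval_prod]

-- With f the minimal polynomial of ζ over K, f'(ζ) = ∏ (ζ - σζ) lies in the different. Since σζ =
-- ζ·ζ^(j+1-1) with ζ^j again primitive, each factor is a unit times ζ^j - 1, of norm p. The tower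
-- formula for discriminants concludes.
open NumberField in
theorem natAbs_discr_le_of_isUnit_autToPow_sub_one {p k : ℕ} [Fact p.Prime] (hp2 : p ≠ 2)
    {K L : Type*} [Field K] [NumberField K] [Field L] [NumberField L] [Algebra K L] [IsGalois K L]
    [IsCyclotomicExtension {p ^ (k + 1)} ℚ L] {ζ : L} (hζ : IsPrimitiveRoot ζ (p ^ (k + 1)))
    (h : ∀ σ : L ≃ₐ[K] L, σ ≠ 1 → IsUnit ((hζ.autToPow K σ : ZMod (p ^ (k + 1))) - 1)) :
    (discr L).natAbs ≤ p ^ (Module.finrank K L - 1) * (discr K).natAbs ^ Module.finrank K L := by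
  classical
  have hp : p.Prime := Fact.out
  have hirr : Irreducible (Polynomial.cyclotomic (p ^ (k + 1)) ℚ) :=
    Polynomial.cyclotomic.irreducible_rat (pow_pos hp.pos _)
  have hadj : Algebra.adjoin K {ζ} = ⊤ := Algebra.adjoin_singleton_eq_top_of_tower ℚ K
    (IsCyclotomicExtension.adjoin_primitive_root_eq_top hζ)
  rw [natAbs_discr_eq_absNorm_differentIdeal_mul_natAbs_discr_pow K (𝓞 K) L (𝓞 L)]
  refine Nat.mul_le_mul_right _ (Nat.le_of_dvd (pow_pos hp.pos _) ?_)
  let z : 𝓞 L := ⟨ζ, hζ.isIntegral (pow_pos hp.pos _)⟩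
  have hmem := aeval_derivative_mem_differentIdeal (𝓞 K) K L z hadj
  have hdvd := Ideal.absNorm_dvd_absNorm_of_le ((Ideal.span_singleton_le_iff_mem _).2 hmem)
  refine hdvd.trans (dvd_of_eq ?_)
  rw [Ideal.absNorm_span_singleton]
  have hcoe : (algebraMap (𝓞 L) L) (Polynomial.aeval z (Polynomial.derivative (minpoly (𝓞 K) z))) =
      ∏ σ ∈ Finset.univ.erase (1 : L ≃ₐ[K] L), (ζ - σ ζ) := by
    have hz : algebraMap (𝓞 L) L z = ζ := rfl
    rw [← aeval_derivative_minpoly_eq_prod hadj, ← hz,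
      minpoly.isIntegrallyClosed_eq_field_fractions K L (Algebra.IsIntegral.isIntegral (R := 𝓞 K) z),
      Polynomial.derivative_map, Polynomial.aeval_map_algebraMap,
      ← Polynomial.aeval_algebraMap_apply]
  have hnorm : ∀ σ ∈ Finset.univ.erase (1 : L ≃ₐ[K] L), |Algebra.norm ℚ (ζ - σ ζ)| = p := by
    intro σ hσ
    have hu := h σ (Finset.ne_of_mem_erase hσ)
    set j := ((hζ.autToPow K σ : ZMod (p ^ (k + 1))) - 1).val with hj
    have hζj : IsPrimitiveRoot (ζ ^ j) (p ^ (k + 1)) := by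
      refine hζ.pow_of_coprime _ ?_
      rw [← ZMod.isUnit_iff_coprime, hj, ZMod.natCast_zmod_val]
      exact hu
    have hσζ : σ ζ = ζ * ζ ^ j := by
      rw [← hζ.autToPow_spec K, ← pow_succ', hζ.pow_eq_pow_iff_natCast_eq]
      simp [hj]
    have h2 : p ^ (k + 1) ≠ 2 := fun h2 ↦ by
      have := (Nat.prime_dvd_prime_iff_eq hp Nat.prime_two).1 (h2 ▸ dvd_pow_self p k.succ_ne_zero)
      exact hp2 this
    rw [hσζ, show ζ - ζ * ζ ^ j = -(ζ * (ζ ^ j - 1)) by ring, ← neg_one_mul, map_mul, map_mul,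
      hζj.norm_sub_one_of_prime_ne_two hirr hp2, hζ.norm_eq_one h2 hirr, abs_mul, one_mul]
    have : Algebra.norm ℚ (-1 : L) = (-1) ^ Module.finrank ℚ L := by
      rw [show (-1 : L) = algebraMap ℚ L (-1) by simp, Algebra.norm_algebraMap]
    rw [this]
    simp
  have hfin : |((Algebra.norm ℤ (Polynomial.aeval z
      (Polynomial.derivative (minpoly (𝓞 K) z))) : ℤ) : ℚ)| = p ^ (Module.finrank K L - 1) := by
    rw [Algebra.coe_norm_int]
    change |Algebra.norm ℚ (algebraMap (𝓞 L) L _)| = _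
    rw [hcoe, map_prod, Finset.abs_prod, Finset.prod_congr rfl hnorm, Finset.prod_const,
      Finset.card_erase_of_mem (Finset.mem_univ _), Finset.card_univ, ← Nat.card_eq_fintype_card,
      IsGalois.card_aut_eq_finrank]
  zify
  exact_mod_cast hfin

/-! ### The trace form in coefficients -/

theorem primitiveRoots_prime_pow_eq_sdiff {p k : ℕ} [Fact p.Prime] :
    primitiveRoots (p ^ (k + 1)) ℂ =
      Polynomial.nthRootsFinset (p ^ (k + 1)) (1 : ℂ) \ Polynomial.nthRootsFinset (p ^ k) 1 := by
  have hp : p.Prime := Fact.out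
  ext ω
  rw [mem_primitiveRoots (pow_pos hp.pos _), Finset.mem_sdiff,
    Polynomial.mem_nthRootsFinset (pow_pos hp.pos _),
    Polynomial.mem_nthRootsFinset (pow_pos hp.pos _)]
  refine ⟨fun h ↦ ⟨h.pow_eq_one, fun h' ↦ ?_⟩, fun h ↦ ?_⟩
  · have := (Nat.pow_dvd_pow_iff_le_right hp.one_lt).1 (h.dvd_of_pow_eq_one _ h')
    omega
  · rw [IsPrimitiveRoot.iff_orderOf]
    exact orderOf_eq_prime_pow h.2 h.1

theorem sum_fiberwise_mul_pow_val {m n : ℕ} [NeZero m] [NeZero n] (h : m ∣ n) (u : ZMod n → ℝ)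
    {ω : ℂ} (hω : ω ^ m = 1) :
    ∑ i, (u i : ℂ) * ω ^ i.val =
      ∑ κ : ZMod m, ((∑ i with ZMod.castHom h (ZMod m) i = κ, u i : ℝ) : ℂ) * ω ^ κ.val := by
  rw [← Finset.sum_fiberwise (g := ZMod.castHom h (ZMod m))]
  refine Finset.sum_congr rfl fun κ _ ↦ ?_
  rw [Complex.ofReal_sum, Finset.sum_mul]
  refine Finset.sum_congr rfl fun i hi ↦ ?_
  rw [← (Finset.mem_filter.1 hi).2, ← ZMod.natCast_zmod_val i, map_natCast, ZMod.natCast_zmod_val,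
    ZMod.val_natCast, ← pow_mod_orderOf, ← pow_mod_orderOf ω (i.val % m),
    Nat.mod_mod_of_dvd _ (orderOf_dvd_of_pow_eq_one hω)]

/-- The trace form of the `p^(k+1)`-st cyclotomic field in terms of coefficients. -/
theorem sum_embeddings_normSq {p k : ℕ} [Fact p.Prime] {L : Type*} [Field L] [CharZero L]
    [IsCyclotomicExtension {p ^ (k + 1)} ℚ L] [Fintype (L →ₐ[ℚ] ℂ)] {ζ : L}
    (hζ : IsPrimitiveRoot ζ (p ^ (k + 1))) (u : ZMod (p ^ (k + 1)) → ℝ) :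
    ∑ φ : L →ₐ[ℚ] ℂ, ‖∑ i, (u i : ℂ) * (φ ζ) ^ i.val‖ ^ 2 =
      (p ^ (k + 1) : ℕ) * ∑ i, u i ^ 2 - (p ^ k : ℕ) * ∑ κ : ZMod (p ^ k),
        (∑ i with ZMod.castHom (pow_dvd_pow p k.le_succ) (ZMod (p ^ k)) i = κ, u i) ^ 2 := by
  have hp : p.Prime := Fact.out
  have : NeZero (p ^ k) := ⟨(pow_pos hp.pos _).ne'⟩
  have hirr : Irreducible (Polynomial.cyclotomic (p ^ (k + 1)) ℚ) :=
    Polynomial.cyclotomic.irreducible_rat (pow_pos hp.pos _)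
  have h1 : ∑ φ : L →ₐ[ℚ] ℂ, ‖∑ i, (u i : ℂ) * (φ ζ) ^ i.val‖ ^ 2 =
      ∑ ω ∈ primitiveRoots (p ^ (k + 1)) ℂ, ‖∑ i, (u i : ℂ) * ω ^ i.val‖ ^ 2 := by
    refine Eq.trans ?_ (Finset.sum_coe_sort (primitiveRoots (p ^ (k + 1)) ℂ)
      fun ω ↦ ‖∑ i, (u i : ℂ) * ω ^ i.val‖ ^ 2)
    exact Fintype.sum_equiv (hζ.embeddingsEquivPrimitiveRoots ℂ hirr) _ _ fun φ ↦ rfl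
  have hsub : Polynomial.nthRootsFinset (p ^ k) (1 : ℂ) ⊆
      Polynomial.nthRootsFinset (p ^ (k + 1)) 1 := by
    intro ω hω
    rw [Polynomial.mem_nthRootsFinset (pow_pos hp.pos _)] at hω ⊢
    rw [pow_succ, pow_mul, hω, one_pow]
  -- Parseval at level p^(k+1) minus Parseval at level p^k: at roots of order dividing p^k only the
  -- fibre sums of the coefficients matter.
  rw [h1, primitiveRoots_prime_pow_eq_sdiff, Finset.sum_sdiff_eq_sub hsub,
    sum_nthRootsFinset_normSq]
  congr 1
  rw [← sum_nthRootsFinset_normSq]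
  refine Finset.sum_congr rfl fun ω hω ↦ ?_
  rw [Polynomial.mem_nthRootsFinset (pow_pos hp.pos _)] at hω
  rw [sum_fiberwise_mul_pow_val (pow_dvd_pow p k.le_succ) u hω]

/-! ### Invariant coefficients and the covering bound -/

theorem ZMod.card_filter_castHom_eq {m n : ℕ} [NeZero m] [NeZero n] (h : m ∣ n) (κ : ZMod m) :
    (Finset.univ.filter fun i ↦ ZMod.castHom h (ZMod m) i = κ).card = n / m := by
  have hconst : ∀ κ' : ZMod m, (Finset.univ.filter fun i ↦ ZMod.castHom h (ZMod m) i = κ').card =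
      (Finset.univ.filter fun i ↦ ZMod.castHom h (ZMod m) i = κ).card := fun κ' ↦
    AddMonoidHom.card_fiber_eq_of_mem_range (ZMod.castHom h (ZMod m))
      (ZMod.castHom_surjective h κ') (ZMod.castHom_surjective h κ)
  have hsum := Finset.card_eq_sum_card_fiberwise (f := ZMod.castHom h (ZMod m))
    (s := Finset.univ) (t := Finset.univ) (by simp)
  simp only [hconst, Finset.sum_const, Finset.card_univ, ZMod.card, smul_eq_mul] at hsum
  exact (Nat.div_eq_of_eq_mul_right (Nat.pos_of_neZero m) hsum).symm

theorem IsPrimitiveRoot.sum_pow_zmod_val {R : Type*} [CommRing R] [IsDomain R] {ω : R} {n : ℕ}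
    [NeZero n] (hω : IsPrimitiveRoot ω n) (hn : 1 < n) : ∑ i : ZMod n, ω ^ i.val = 0 := by
  have h : ω * ∑ i : ZMod n, ω ^ i.val = ∑ i : ZMod n, ω ^ i.val := by
    rw [Finset.mul_sum, ← Equiv.sum_comp (Equiv.addRight (1 : ZMod n)) fun i : ZMod n ↦ ω ^ i.val]
    refine Finset.sum_congr rfl fun i _ ↦ ?_
    rw [← pow_succ', hω.pow_eq_pow_iff_natCast_eq]
    simp
  have h2 : (ω - 1) * ∑ i : ZMod n, ω ^ i.val = 0 := by rw [sub_mul, h, one_mul, sub_self]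
  exact (mul_eq_zero.1 h2).resolve_left (sub_ne_zero.2 (hω.ne_one hn))

theorem IsPrimitiveRoot.exists_coeff_of_adjoin_eq_top {F L : Type*} [CommRing F] [CommRing L]
    [Algebra F L] {ζ : L} {n : ℕ} [NeZero n] (hζ : IsPrimitiveRoot ζ n)
    (hadj : Algebra.adjoin F {ζ} = ⊤) (x : L) :
    ∃ b : ZMod n → F, x = ∑ i, algebraMap F L (b i) * ζ ^ i.val := by
  have hx : x ∈ Algebra.adjoin F {ζ} := hadj ▸ Algebra.mem_top
  obtain ⟨f, rfl⟩ := Algebra.adjoin_mem_exists_aeval F ζ hx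
  refine ⟨fun i ↦ ∑ j ∈ Finset.range (f.natDegree + 1) with ((j : ℕ) : ZMod n) = i, f.coeff j, ?_⟩
  rw [Polynomial.aeval_eq_sum_range, ← Finset.sum_fiberwise (g := fun j : ℕ ↦ (j : ZMod n))]
  refine Finset.sum_congr rfl fun i _ ↦ ?_
  rw [map_sum, Finset.sum_mul]
  refine Finset.sum_congr rfl fun j hj ↦ ?_
  rw [Algebra.smul_def, ← (Finset.mem_filter.1 hj).2]
  congr 1
  rw [hζ.pow_eq_pow_iff_natCast_eq]
  simp

/-- σ permutes the powers of ζ by multiplying exponents by a unit, and the twist of the coefficients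
compensates for this. -/
theorem IsPrimitiveRoot.map_sum_mul_pow_zmod_val {K L : Type*} [CommRing K] [CommRing L]
    [IsDomain L] [Algebra K L] {ζ : L} {n : ℕ} [NeZero n] (hζ : IsPrimitiveRoot ζ n)
    (σ : L ≃ₐ[K] L) {g : ZMod n → L} (hg : ∀ i, σ (g i) = g i) :
    σ (∑ i, g (hζ.autToPow K σ * i) * ζ ^ i.val) = ∑ i, g i * ζ ^ i.val := by
  rw [map_sum, ← Equiv.sum_comp (Units.mulLeft (hζ.autToPow K σ)) fun i ↦ g i * ζ ^ i.val]
  refine Finset.sum_congr rfl fun i _ ↦ ?_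
  rw [map_mul, hg, map_pow, ← hζ.autToPow_spec K, ← pow_mul, Units.mulLeft_apply]
  congr 1
  rw [hζ.pow_eq_pow_iff_natCast_eq]
  simp

/-- Elements of a subfield `K` of a cyclotomic field have `Gal(L/K)`-invariant coefficients. -/
theorem IsPrimitiveRoot.exists_invariant_coeff {K L : Type*} [Field K] [Field L] [CharZero L]
    [Algebra K L] [FiniteDimensional K L] {ζ : L} {n : ℕ} [NeZero n] (hζ : IsPrimitiveRoot ζ n)
    (hadj : Algebra.adjoin ℚ {ζ} = ⊤) (x : K) :
    ∃ a : ZMod n → ℚ, algebraMap K L x = ∑ i, (a i : L) * ζ ^ i.val ∧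
      ∀ (σ : L ≃ₐ[K] L) (i : ZMod n), a (hζ.autToPow K σ * i) = a i := by
  obtain ⟨b, hb⟩ := hζ.exists_coeff_of_adjoin_eq_top hadj (algebraMap K L x)
  simp only [eq_ratCast] at hb
  have he : ((Fintype.card (L ≃ₐ[K] L) : ℕ) : L) ≠ 0 := Nat.cast_ne_zero.2 Fintype.card_ne_zero
  -- Any coefficients of x, averaged over Gal(L/K), still represent x because x is fixed.
  refine ⟨fun i ↦ (Fintype.card (L ≃ₐ[K] L) : ℚ)⁻¹ * ∑ σ : L ≃ₐ[K] L, b (hζ.autToPow K σ * i),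
    ?_, fun τ i ↦ ?_⟩
  · have h : ∀ σ : L ≃ₐ[K] L,
        ∑ i, (b (hζ.autToPow K σ * i) : L) * ζ ^ i.val = algebraMap K L x := by
      intro σ
      apply σ.injective
      rw [hζ.map_sum_mul_pow_zmod_val σ (g := fun i ↦ (b i : L)) (fun i ↦ map_ratCast σ _), ← hb,
        σ.commutes]
    have h2 : ∑ σ : L ≃ₐ[K] L, ∑ i, (b (hζ.autToPow K σ * i) : L) * ζ ^ i.val =
        Fintype.card (L ≃ₐ[K] L) * algebraMap K L x := by
      simp [h]
    rw [Finset.sum_comm] at h2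
    push_cast
    simp_rw [mul_assoc, ← Finset.mul_sum, Finset.sum_mul]
    rw [h2, inv_mul_cancel_left₀ he]
  · refine congrArg (fun z ↦ (Fintype.card (L ≃ₐ[K] L) : ℚ)⁻¹ * z) ?_
    rw [← Equiv.sum_comp (Equiv.mulRight τ) fun σ ↦ b (hζ.autToPow K σ * i)]
    simp [mul_assoc]

open NumberField in
/-- The covering bound: every element of `K` is close to an integer of `K` for the trace form. -/
theorem exists_ringOfIntegers_sum_embeddings_normSq_le {p k : ℕ} [Fact p.Prime]
    {K L : Type*} [Field K] [NumberField K] [Field L] [NumberField L] [Algebra K L] [IsGalois K L]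
    [IsCyclotomicExtension {p ^ (k + 1)} ℚ L] (x : K) :
    ∃ c : 𝓞 K, ∑ φ : L →ₐ[ℚ] ℂ, ‖φ (algebraMap K L (x - c))‖ ^ 2 ≤
      ((p : ℝ) ^ k) ^ 2 * ((p : ℝ) ^ 2 - 1) / 12 := by
  have hp : p.Prime := Fact.out
  have : NeZero (p ^ k) := ⟨(pow_pos hp.pos _).ne'⟩
  have hζ := IsCyclotomicExtension.zeta_spec (p ^ (k + 1)) ℚ L
  set ζ := IsCyclotomicExtension.zeta (p ^ (k + 1)) ℚ L
  obtain ⟨a, hax, hainv⟩ := hζ.exists_invariant_coeff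
    (IsCyclotomicExtension.adjoin_primitive_root_eq_top hζ) x
  obtain ⟨t, ht⟩ := exists_shift_sum_sub_round_sq_le
    (ZMod.castHom (pow_dvd_pow p k.le_succ) (ZMod (p ^ k))) hp.pos
    (fun κ ↦ by rw [ZMod.card_filter_castHom_eq, Nat.succ_eq_add_one, pow_succ,
      Nat.mul_div_cancel_left _ (pow_pos hp.pos k)]) (fun i ↦ (a i : ℝ))
  let m : ZMod (p ^ (k + 1)) → ℤ := fun i ↦ round ((a i : ℝ) - t)
  -- The shift is the same for all coefficients, so the rounded ones stay invariant and their sum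
  -- descends to K.
  have hfix : ∀ σ : L ≃ₐ[K] L, σ (∑ i, (m i : L) * ζ ^ i.val) = ∑ i, (m i : L) * ζ ^ i.val := by
    intro σ
    conv_rhs => rw [← hζ.map_sum_mul_pow_zmod_val σ (g := fun i ↦ (m i : L))
      (fun i ↦ map_intCast σ _)]
    simp only [m, hainv]
  obtain ⟨c, hc⟩ := (IsGalois.mem_range_algebraMap_iff_fixed _).2 hfix
  have hcint : IsIntegral ℤ c := by
    rw [← isIntegral_algebraMap_iff (FaithfulSMul.algebraMap_injective K L), hc]
    refine IsIntegral.sum _ fun i _ ↦ IsIntegral.mul ?_ ((hζ.isIntegral (pow_pos hp.pos _)).pow _)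
    exact isIntegral_algebraMap (R := ℤ) (x := m i)
  refine ⟨⟨c, hcint⟩, ?_⟩
  have hφ : ∀ φ : L →ₐ[ℚ] ℂ, φ (algebraMap K L (x - c)) =
      ∑ i, (((a i : ℝ) - t - round ((a i : ℝ) - t) : ℝ) : ℂ) * (φ ζ) ^ i.val := by
    intro φ
    have h0 : ∑ i : ZMod (p ^ (k + 1)), (φ ζ) ^ i.val = 0 := (hζ.map_of_injective φ.injective).sum_pow_zmod_val
      (Nat.one_lt_pow k.succ_ne_zero hp.one_lt)
    have h1 : φ (algebraMap K L (x - c)) = ∑ i, ((a i : ℂ) - m i) * (φ ζ) ^ i.val := by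
      rw [map_sub, hax, hc, ← Finset.sum_sub_distrib, map_sum]
      refine Finset.sum_congr rfl fun i _ ↦ ?_
      rw [← sub_mul, map_mul, map_sub, map_pow, map_ratCast, map_intCast]
    -- The real shift t is harmless: it multiplies a vanishing sum.
    calc _ = ∑ i, ((a i : ℂ) - m i) * (φ ζ) ^ i.val - t * ∑ i : ZMod (p ^ (k + 1)), (φ ζ) ^ i.val := by
          rw [h1, h0, mul_zero, sub_zero]
      _ = _ := by
          rw [Finset.mul_sum, ← Finset.sum_sub_distrib]
          refine Finset.sum_congr rfl fun i _ ↦ ?_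
          push_cast [m]
          ring
  calc ∑ φ : L →ₐ[ℚ] ℂ, ‖φ (algebraMap K L (x - c))‖ ^ 2 = _ := by
        simp only [hφ]
        exact sum_embeddings_normSq hζ fun i ↦ (a i : ℝ) - t - round ((a i : ℝ) - t)
    _ ≤ _ := by simpa only [ZMod.card, Nat.cast_pow] using ht

/-! ### AM-GM and the numerical comparison -/

theorem Finset.prod_le_sum_div_card_pow {ι : Type*} [Fintype ι] [Nonempty ι] {z : ι → ℝ}
    (hz : ∀ i, 0 ≤ z i) : ∏ i, z i ≤ ((∑ i, z i) / Fintype.card ι) ^ Fintype.card ι := by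
  have hn : (Fintype.card ι : ℝ) ≠ 0 := Nat.cast_ne_zero.2 Fintype.card_ne_zero
  have h := Real.geom_mean_le_arith_mean_weighted Finset.univ
    (fun _ : ι ↦ (Fintype.card ι : ℝ)⁻¹) z (fun _ _ ↦ by positivity) (by simp [hn])
    fun i _ ↦ hz i
  rw [← Finset.mul_sum, Real.finsetProd_rpow _ _ fun i _ ↦ hz i] at h
  have h2 := pow_le_pow_left₀ (Real.rpow_nonneg (Finset.prod_nonneg fun i _ ↦ hz i) _) h
    (Fintype.card ι)
  rwa [Real.rpow_inv_natCast_pow (Finset.prod_nonneg fun i _ ↦ hz i) Fintype.card_ne_zero,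
    inv_mul_eq_div] at h2

theorem sq_mul_two_pow_le_five_pow {p : ℕ} (hp : 5 ≤ p) : p ^ 2 * 2 ^ (p - 1) ≤ 5 ^ (p - 1) := by
  induction p, hp using Nat.le_induction with
  | base => norm_num
  | succ n hn ih =>
    obtain ⟨m, rfl⟩ : ∃ m, n = m + 1 := ⟨n - 1, by omega⟩
    simp only [Nat.add_sub_cancel] at ih ⊢
    calc (m + 1 + 1) ^ 2 * 2 ^ (m + 1) = 2 * (m + 1 + 1) ^ 2 * 2 ^ m := by ring
      _ ≤ 5 * (m + 1) ^ 2 * 2 ^ m := Nat.mul_le_mul_right _ (by nlinarith)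
      _ = 5 * ((m + 1) ^ 2 * 2 ^ m) := by ring
      _ ≤ 5 * 5 ^ m := Nat.mul_le_mul_left _ ih
      _ = 5 ^ (m + 1) := by ring

/-- This is what remains of the comparison of the AM-GM bound with D_K, where e + 1 = [L:K]. The
condition k ≠ 0 is essential: p = 3, k = 0, e = 1 would give 144 ≤ 81. -/
theorem pow_mul_succ_pow_le_three_mul_pow {p k e : ℕ} (hp : p.Prime) (hp2 : p ≠ 2) (hk : k ≠ 0)
    (he : e + 1 < p) :
    p ^ (e + p ^ k) * (p + 1) ^ (p ^ k * (p - 1)) ≤ (3 * p) ^ (p ^ k * (p - 1)) := by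
  have hmp : p ≤ p ^ k := Nat.le_self_pow hk p
  set m := p ^ k
  have hp3 : 3 ≤ p := by have := hp.two_le; omega
  rcases hp3.eq_or_lt with rfl | hp4
  · have key : ∀ m, 3 ≤ m → 3 * 48 ^ m ≤ 81 ^ m := by
      intro m hm
      induction m, hm using Nat.le_induction with
      | base => norm_num
      | succ n _ ih => rw [pow_succ, pow_succ]; omega
    calc 3 ^ (e + m) * (3 + 1) ^ (m * (3 - 1)) ≤ 3 ^ (1 + m) * (3 + 1) ^ (m * (3 - 1)) :=
          Nat.mul_le_mul_right _ (Nat.pow_le_pow_right (by norm_num) (by omega))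
      _ = 3 * 48 ^ m := by
          rw [pow_add, mul_comm m, pow_mul, mul_assoc, ← mul_pow]
          norm_num
      _ ≤ 81 ^ m := key m hmp
      _ = (3 * 3) ^ (m * (3 - 1)) := by rw [mul_comm m, pow_mul]; norm_num
  · have hp5 : 5 ≤ p := by
      rcases (show 4 ≤ p from hp4).eq_or_lt with rfl | h
      · exact absurd hp (by norm_num)
      · exact h
    -- For p ≥ 5 one has (p + 1)/(3p) ≤ 2/5; and e < p ≤ m lets p^(2m) absorb p^(e+m).
    have h1 : p ^ 2 * (p + 1) ^ (p - 1) ≤ (3 * p) ^ (p - 1) := by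
      refine Nat.le_of_mul_le_mul_right ?_ (pow_pos (by norm_num : 0 < 5) (p - 1))
      calc p ^ 2 * (p + 1) ^ (p - 1) * 5 ^ (p - 1) = p ^ 2 * ((p + 1) * 5) ^ (p - 1) := by
            rw [mul_pow, mul_assoc]
        _ ≤ p ^ 2 * (2 * (3 * p)) ^ (p - 1) :=
            Nat.mul_le_mul_left _ (Nat.pow_le_pow_left (by omega) _)
        _ = (3 * p) ^ (p - 1) * (p ^ 2 * 2 ^ (p - 1)) := by rw [mul_pow 2]; ring
        _ ≤ _ := Nat.mul_le_mul_left _ (sq_mul_two_pow_le_five_pow hp5)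
    calc p ^ (e + m) * (p + 1) ^ (m * (p - 1)) ≤ p ^ (2 * m) * (p + 1) ^ (m * (p - 1)) :=
          Nat.mul_le_mul_right _ (Nat.pow_le_pow_right hp.pos (by omega))
      _ = (p ^ 2 * (p + 1) ^ (p - 1)) ^ m := by
          rw [mul_pow, ← pow_mul, ← pow_mul, mul_comm m (p - 1)]
      _ ≤ ((3 * p) ^ (p - 1)) ^ m := Nat.pow_le_pow_left h1 m
      _ = (3 * p) ^ (m * (p - 1)) := by rw [← pow_mul, mul_comm m]

/-- Reduction mod p is injective on Gal(L/K), so its order is at most p - 1. -/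
theorem finrank_lt_of_isUnit_autToPow_sub_one {p k : ℕ} [Fact p.Prime]
    {K L : Type*} [Field K] [Field L] [Algebra K L] [FiniteDimensional K L] [IsGalois K L]
    {ζ : L} (hζ : IsPrimitiveRoot ζ (p ^ (k + 1)))
    (h : ∀ σ : L ≃ₐ[K] L, σ ≠ 1 → IsUnit ((hζ.autToPow K σ : ZMod (p ^ (k + 1))) - 1)) :
    Module.finrank K L < p := by
  have hp : p.Prime := Fact.out
  have hdvd : p ∣ p ^ (k + 1) := dvd_pow_self p k.succ_ne_zero
  have hinj : Function.Injective ((ZMod.unitsMap hdvd).comp (hζ.autToPow K)) := by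
    rw [injective_iff_map_eq_one]
    intro σ hσ
    by_contra hne
    have hu := (h σ hne).map (ZMod.castHom hdvd (ZMod p))
    have h1 : ZMod.castHom hdvd (ZMod p) (hζ.autToPow K σ) = 1 := congrArg Units.val hσ
    rw [map_sub, h1, map_one, sub_self] at hu
    exact not_isUnit_zero hu
  have hcard := Nat.card_le_card_of_injective _ hinj
  rw [IsGalois.card_aut_eq_finrank, Nat.card_eq_fintype_card, ZMod.card_units p] at hcard
  have := hp.pos
  omega

/-! ### The norm bound and the theorem -/

open NumberField in
theorem exists_abs_norm_sub_le_of_isUnit_autToPow_sub_one {p k : ℕ} [Fact p.Prime] (hp2 : p ≠ 2)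
    (hk : k ≠ 0) {K L : Type*} [Field K] [NumberField K] [Field L] [NumberField L] [Algebra K L]
    [IsGalois K L] [IsCyclotomicExtension {p ^ (k + 1)} ℚ L] {ζ : L}
    (hζ : IsPrimitiveRoot ζ (p ^ (k + 1)))
    (h : ∀ σ : L ≃ₐ[K] L, σ ≠ 1 → IsUnit ((hζ.autToPow K σ : ZMod (p ^ (k + 1))) - 1)) (x : K) :
    ∃ c : 𝓞 K, ((|Algebra.norm ℚ (x - c)| : ℚ) : ℝ) ≤
      ((2 : ℝ) ^ Module.finrank ℚ K)⁻¹ * Real.sqrt |(discr K : ℝ)| := by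
  have hp : p.Prime := Fact.out
  obtain ⟨c, hc⟩ := exists_ringOfIntegers_sum_embeddings_normSq_le (p := p) (k := k) (L := L) x
  refine ⟨c, ?_⟩
  set y : K := x - c
  obtain ⟨e, he⟩ : ∃ e, Module.finrank K L = e + 1 :=
    Nat.exists_eq_succ_of_ne_zero Module.finrank_pos.ne'
  have hep : e + 1 < p := he ▸ finrank_lt_of_isUnit_autToPow_sub_one hζ h
  have hdisc := natAbs_discr_le_of_isUnit_autToPow_sub_one hp2 hζ h
  have hnum := pow_mul_succ_pow_le_three_mul_pow hp hp2 hk hep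
  set n := Module.finrank ℚ K
  set N := p ^ k * (p - 1) with hN
  have hirr : Irreducible (Polynomial.cyclotomic (p ^ (k + 1)) ℚ) :=
    Polynomial.cyclotomic.irreducible_rat (pow_pos hp.pos _)
  have hfinL : Module.finrank ℚ L = N := by
    rw [IsCyclotomicExtension.finrank L hirr, Nat.totient_prime_pow_succ hp]
  have hnN : n * (e + 1) = N := by rw [← he, ← hfinL]; exact Module.finrank_mul_finrank ℚ K L
  have hcardφ : Fintype.card (L →ₐ[ℚ] ℂ) = N := by rw [← hfinL, AlgHom.card]
  have hN0 : 0 < N := hfinL ▸ Module.finrank_pos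
  have : Nonempty (L →ₐ[ℚ] ℂ) := Fintype.card_pos_iff.1 (hcardφ ▸ hN0)
  have hpR : (0 : ℝ) < p := by exact_mod_cast hp.pos
  have hp1 : ((p - 1 : ℕ) : ℝ) = p - 1 := by rw [Nat.cast_sub hp.one_le, Nat.cast_one]
  set ν : ℝ := ((|Algebra.norm ℚ y| : ℚ) : ℝ) with hν
  -- For y in K the norm from L is the (e + 1)-st power of the norm from K.
  have hnormL : ν ^ (e + 1) = ∏ φ : L →ₐ[ℚ] ℂ, ‖φ (algebraMap K L y)‖ := by
    rw [← norm_prod, ← Algebra.norm_eq_prod_embeddings, ← Algebra.norm_norm (S := K),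
      Algebra.norm_algebraMap, he, map_pow, hν]
    simp
  have hamgm : (ν ^ 2) ^ (e + 1) ≤ ((p : ℝ) ^ k * (p + 1) / 12) ^ N := by
    rw [← pow_mul, mul_comm, pow_mul, hnormL, ← Finset.prod_pow]
    refine (Finset.prod_le_sum_div_card_pow fun φ ↦ sq_nonneg _).trans ?_
    rw [hcardφ]
    refine pow_le_pow_left₀ (by positivity) ?_ N
    rw [div_le_iff₀ (by exact_mod_cast hN0)]
    refine hc.trans (le_of_eq ?_)
    rw [hN]
    push_cast [hp1]
    ring
  have hdiscL : (discr L).natAbs = p ^ (p ^ k * ((p - 1) * (k + 1) - 1)) := by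
    rw [IsCyclotomicExtension.Rat.discr_prime_pow_succ p k L, Int.natAbs_mul, Int.natAbs_pow,
      Int.natAbs_pow]
    simp
  have hexp : p ^ k * ((p - 1) * (k + 1) - 1) + p ^ k = N * (k + 1) := by
    have : 1 ≤ (p - 1) * (k + 1) :=
      Nat.mul_pos (Nat.sub_pos_of_lt hp.one_lt) k.succ_pos
    rw [← Nat.mul_succ, Nat.succ_eq_add_one, Nat.sub_add_cancel this, hN, mul_assoc]
  set D : ℝ := |(discr K : ℝ)| with hD
  have hD' : D = ((discr K).natAbs : ℝ) := by rw [hD, Nat.cast_natAbs, Int.cast_abs]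
  rw [he, Nat.add_sub_cancel, hdiscL] at hdisc
  -- Both sides carry an extra p^(p^k), which clears the subtraction in D_L = p^(N(k+1) - p^k).
  have hdiscR : (p : ℝ) ^ (N * (k + 1)) ≤ p ^ (e + p ^ k) * D ^ (e + 1) := by
    rw [← hexp, pow_add, pow_add, hD', mul_right_comm]
    exact mul_le_mul_of_nonneg_right (by exact_mod_cast hdisc) (by positivity)
  have hnumR : (p : ℝ) ^ (e + p ^ k) * ((p : ℝ) + 1) ^ N ≤ (3 * p) ^ N := by exact_mod_cast hnum
  have hfinal : ((p : ℝ) ^ k * (p + 1) / 3) ^ N ≤ D ^ (e + 1) := by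
    refine le_of_mul_le_mul_left ?_ (pow_pos hpR (e + p ^ k))
    refine le_trans ?_ hdiscR
    calc (p : ℝ) ^ (e + p ^ k) * ((p : ℝ) ^ k * (p + 1) / 3) ^ N
        = (p : ℝ) ^ (e + p ^ k) * ((p : ℝ) + 1) ^ N * ((p : ℝ) ^ k / 3) ^ N := by
          rw [mul_assoc, ← mul_pow]; ring_nf
      _ ≤ (3 * p) ^ N * ((p : ℝ) ^ k / 3) ^ N := by gcongr
      _ = (p : ℝ) ^ (N * (k + 1)) := by
          rw [← mul_pow, mul_comm N (k + 1), pow_mul (p : ℝ), pow_succ (p : ℝ) k]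
          congr 1
          ring
  -- Splitting 12 = 4 · 3 isolates 4^(-N), whose (e + 1)-st root is 4^(-n) since N = n(e + 1).
  have hsq : ν ^ 2 ≤ ((4 : ℝ) ^ n)⁻¹ * D := by
    refine le_of_pow_le_pow_left₀ e.succ_ne_zero (by positivity) (hamgm.trans ?_)
    calc ((p : ℝ) ^ k * (p + 1) / 12) ^ N
        = ((4 : ℝ) ^ N)⁻¹ * ((p : ℝ) ^ k * (p + 1) / 3) ^ N := by
          rw [← inv_pow, ← mul_pow]; ring_nf
      _ ≤ ((4 : ℝ) ^ N)⁻¹ * D ^ (e + 1) := by gcongr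
      _ = (((4 : ℝ) ^ n)⁻¹ * D) ^ (e + 1) := by rw [mul_pow, inv_pow, ← pow_mul, hnN]
  refine (Real.le_sqrt_of_sq_le hsq).trans (le_of_eq ?_)
  rw [Real.sqrt_mul (by positivity), Real.sqrt_inv,
    show (4 : ℝ) ^ n = ((2 : ℝ) ^ n) ^ 2 by rw [← pow_mul, mul_comm, pow_mul]; norm_num,
    Real.sqrt_sq (by positivity)]

theorem mainTheorem1 (K : Type*) [Field K] [NumberField K] [IsAbelianGalois ℚ K]
    (p r : ℕ) (hp : p.Prime) (hp_odd : Odd p) (hr : 2 ≤ r)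
    (hK : EuclideanMinimum.conductor K = p ^ r) :
    EuclideanMinimum.euclideanMinimum K ≤
      ENNReal.ofReal (((2 : ℝ) ^ Module.finrank ℚ K)⁻¹ *
        Real.sqrt |(NumberField.discr K : ℝ)|) := by
  have : Fact p.Prime := ⟨hp⟩
  have hp2 : p ≠ 2 := by
    rintro rfl
    exact absurd hp_odd (by decide)
  obtain ⟨k, rfl⟩ : ∃ k, r = k + 1 := ⟨r - 1, by omega⟩
  -- The infimum of the empty set is 0, which is not p^r; so the conductor is attained and K embeds
  -- into L.
  have hne : {m : ℕ | 0 < m ∧ Nonempty (K →+* CyclotomicField m ℚ)}.Nonempty := by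
    rw [Set.nonempty_iff_ne_empty]
    intro h
    rw [EuclideanMinimum.conductor, h, Nat.sInf_empty] at hK
    exact (pow_pos hp.pos _).ne hK
  have hmem := Nat.sInf_mem hne
  rw [← EuclideanMinimum.conductor, hK] at hmem
  obtain ⟨-, ⟨f⟩⟩ := hmem
  have hmin : IsEmpty (K →+* CyclotomicField (p ^ k) ℚ) := by
    refine ⟨fun g ↦ ?_⟩
    have h : EuclideanMinimum.conductor K ≤ p ^ k := Nat.sInf_le ⟨pow_pos hp.pos _, ⟨g⟩⟩
    rw [hK, Nat.pow_le_pow_iff_right hp.one_lt] at h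
    omega
  have : NeZero (p ^ k) := ⟨(pow_pos hp.pos _).ne'⟩
  let L := CyclotomicField (p ^ (k + 1)) ℚ
  let C := CyclotomicField (p ^ k) ℚ
  have hL : IsCyclotomicExtension {p ^ (k + 1)} ℚ L :=
    CyclotomicField.isCyclotomicExtension (p ^ (k + 1)) ℚ
  have hC : IsCyclotomicExtension {p ^ k} ℚ C :=
    CyclotomicField.isCyclotomicExtension (p ^ k) ℚ
  have : NumberField L := IsCyclotomicExtension.numberField {p ^ (k + 1)} ℚ L
  let _ : Algebra K L := f.toAlgebra
  have : IsGalois ℚ L := IsCyclotomicExtension.isGalois {p ^ (k + 1)} ℚ L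
  have : IsGalois K L := IsGalois.tower_top_of_isGalois ℚ K L
  have hζ := IsCyclotomicExtension.zeta_spec (p ^ (k + 1)) ℚ L
  refine iSup_le fun x ↦ ?_
  obtain ⟨c, hc⟩ := exists_abs_norm_sub_le_of_isUnit_autToPow_sub_one hp2 (by omega) hζ
    (fun σ hσ ↦ isUnit_autToPow_sub_one (C := C) hp2 (by omega) hζ hmin hσ) x
  exact iInf_le_of_le c (ENNReal.ofReal_le_ofReal hc)
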